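/- Let $n\ge 1$ be an integer and $\gamma>0$ a real number, and let $S\subseteq\mathbb R[x_1,\dots,x_n]$ be the semiring generated by $x_1,\dots,x_n$ and $\gamma-\sum_{j=1}^n x_j$, that is, the set of all finite sums of products of these polynomials with nonnegative real coefficients. Put $$\Delta^n_\gamma=\Big\{\xi\in[0,\infty)^n:\ \sum_{j=1}^n\xi_j\le\gamma\Big\}.$$ Let $J\subseteq\mathbb R$ be closed, let $\mathrm{Pos}(J)=\{q\in\mathbb R[z]: q(t)\ge 0\text{ for all }t\in J\}$, and let $S\otimes\mathrm{Pos}(J)\subseteq\mathbb R[x_1,\dots,x_n,z]$ be the set of all finite sums of products $s\,q$ with $s\in S$ and $q\in\mathrm{Pos}(J)$. Let $k\ge 0$ be an integer and let $p=\sum_{i=0}^{2k}p_iz^i\in\mathbb R[x_1,\dots,x_n,z]$ with $p_0,\dots,p_{2k}\in\mathbb R[x_1,\dots,x_n]$. If $p(\xi,\eta)>0$ for all $(\xi,\eta)\in\Delta^n_\gamma\times J$ and $p_{2k}(\theta)>0$ for all $\theta\in\Delta^n_\gamma$, then there exists a real number $\varepsilon>0$ such that $$p\in\varepsilon(1+z^2)^k+S\otimes\mathrm{Pos}(J).$$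 -/

import Mathlib

open scoped NNReal

namespace Cylinder

/-- The semiring of a commutative real algebra `A` generated by a set `G`: the smallest subset of
`A` that contains `G` and `1` and is closed under addition, multiplication and multiplication by
nonnegative real scalars, i.e. the finite sums of products of elements of `G` with nonnegative
real coefficients. -/
def generatedSemiring {A : Type*} [CommRing A] [Algebra ℝ A] (G : Set A) : Set A :=
  (Algebra.adjoin ℝ≥0 G : Set A)

/-- `Pos(J)`: the real polynomials in one variable that are nonnegative on `J`. -/
def Pos (J : Set ℝ) : Set (Polynomial ℝ) :=
  {q | ∀ t ∈ J, 0 ≤ q.eval t}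

/-- `S ⊗ P` inside `A[z] ≅ A ⊗ ℝ[z]`, for `S ⊆ A` and `P ⊆ ℝ[z]`: the finite sums of products
`s * q` with `s ∈ S` (a constant of `A[z]`) and `q ∈ P` (a polynomial with real coefficients). -/
def tensor {A : Type*} [CommRing A] [Algebra ℝ A] (S : Set A) (P : Set (Polynomial ℝ)) :
    Set (Polynomial A) :=
  {a | ∃ (m : ℕ) (s : Fin m → A) (q : Fin m → Polynomial ℝ),
    (∀ i, s i ∈ S) ∧ (∀ i, q i ∈ P) ∧
      a = ∑ i, Polynomial.C (s i) * (q i).map (algebraMap ℝ A)}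

/-- The simplex of all `ξ` in `[0,∞)^n` with `ξ 1 + ... + ξ n ≤ γ`. -/
def simplex (n : ℕ) (γ : ℝ) : Set (Fin n → ℝ) :=
  {ξ | (∀ j, 0 ≤ ξ j) ∧ ∑ j, ξ j ≤ γ}

/-- The semiring of `ℝ[x_1,…,x_n]` generated by `x_1,…,x_n` and `γ - (x_1 + ... + x_n)`. -/
def simplexSemiring (n : ℕ) (γ : ℝ) : Set (MvPolynomial (Fin n) ℝ) :=
  generatedSemiring
    (Set.range (fun j : Fin n => (MvPolynomial.X j : MvPolynomial (Fin n) ℝ)) ∪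
      {MvPolynomial.C γ - ∑ j : Fin n, MvPolynomial.X j})

end Cylinder

open Filter Finset

namespace Cylinder

/-! A Pólya–Bernstein argument carried out coefficientwise in `z`. Compactness, with the leading
coefficient controlling large `|z|`, gives `p ≥ ε (1 + z²)^k` on the cylinder
(`exists_uniform_lower_bound`). Expanding `γ ^ N`, the `N`-th power of the sum of the barycentric
coordinates, over words gives `γ ^ N * p_i = ∑ b_i(w) ∏ (letters of w)`, with `b_i(w)` close to
`p_i` at the letter frequencies of `w` (`hasBernsteinExpansions`). For large `N`, each `∑ b_i(w)
z^i` thus exceeds `(ε/2) (1 + z²)^k` on `J`. The excess lies in `Pos J` and is the factor paired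
with the word `w`. -/

/-- The unnormalised barycentric coordinates `x_1, …, x_n, γ - (x_1 + ... + x_n)`. -/
noncomputable def barycentric (n : ℕ) (γ : ℝ) : Option (Fin n) → MvPolynomial (Fin n) ℝ
  | none => MvPolynomial.C γ - ∑ j : Fin n, MvPolynomial.X j
  | some j => MvPolynomial.X j

theorem sum_barycentric (n : ℕ) (γ : ℝ) :
    ∑ i, barycentric n γ i = MvPolynomial.C γ := by
  simp [Fintype.sum_option, barycentric]

theorem prod_barycentric_mem (n : ℕ) (γ : ℝ) {N : ℕ} (w : Fin N → Option (Fin n)) :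
    ∏ t, barycentric n γ (w t) ∈ simplexSemiring n γ := by
  refine Subalgebra.prod_mem _ fun t _ => Algebra.subset_adjoin ?_
  cases h : w t with
  | none => right; simp [barycentric]
  | some j => left; exact ⟨j, rfl⟩

theorem sum_prod_barycentric (n : ℕ) (γ : ℝ) (N : ℕ) :
    ∑ w : Fin N → Option (Fin n), ∏ t, barycentric n γ (w t) = MvPolynomial.C (γ ^ N) := by
  rw [← Fintype.piFinset_univ, ← Finset.prod_univ_sum]
  simp only [sum_barycentric]
  simp

/-- The point of the simplex given by the letter frequencies of the word `w`. -/
noncomputable def samplePoint {n : ℕ} (γ : ℝ) {N : ℕ} (w : Fin N → Option (Fin n)) :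
    Fin n → ℝ :=
  fun j => γ / N * ∑ t, if w t = some j then 1 else 0

theorem samplePoint_mem {n : ℕ} {γ : ℝ} (hγ : 0 ≤ γ) {N : ℕ} (w : Fin N → Option (Fin n)) :
    samplePoint γ w ∈ simplex n γ := by
  refine ⟨fun j => mul_nonneg (by positivity)
    (Finset.sum_nonneg fun t _ => by split_ifs <;> norm_num), ?_⟩
  simp only [samplePoint]
  rw [← Finset.mul_sum, Finset.sum_comm]
  have h : ∑ t : Fin N, ∑ j : Fin n, (if w t = some j then (1 : ℝ) else 0) ≤ N := by
    calc _ ≤ ∑ _t : Fin N, (1 : ℝ) := by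
          refine Finset.sum_le_sum fun t _ => ?_
          cases w t with
          | none => simp
          | some i => simp
      _ = N := by simp
  rcases Nat.eq_zero_or_pos N with rfl | hN
  · simpa using hγ
  · have hN' : (0 : ℝ) < N := by exact_mod_cast hN
    calc γ / N * _ ≤ γ / N * N := by gcongr
      _ = γ := by field_simp

theorem isCompact_simplex (n : ℕ) (γ : ℝ) : IsCompact (simplex n γ) := by
  refine (isCompact_Icc (a := (0 : Fin n → ℝ)) (b := fun _ => γ)).of_isClosed_subset ?_ ?_
  · refine IsClosed.inter (s₁ := {ξ : Fin n → ℝ | ∀ j, 0 ≤ ξ j}) ?_ ?_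
    · simp only [Set.ofPred_forall]
      exact isClosed_iInter fun j => isClosed_le continuous_const (continuous_apply j)
    · exact isClosed_le (continuous_finsetSum _ fun j _ => continuous_apply j) continuous_const
  · rintro ξ ⟨h0, h1⟩
    exact ⟨h0, fun j => (Finset.single_le_sum (fun i _ => h0 i) (Finset.mem_univ j)).trans h1⟩

theorem dist_samplePoint_removeNth_le {n : ℕ} {γ : ℝ} (hγ : 0 ≤ γ) {N : ℕ} (hN : 0 < N)
    (w : Fin (N + 1) → Option (Fin n)) (t : Fin (N + 1)) :
    dist (samplePoint γ (t.removeNth w)) (samplePoint γ w) ≤ γ / (N + 1 : ℝ) := by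
  refine (dist_pi_le_iff (by positivity)).2 fun j => ?_
  have hN' : (0 : ℝ) < N := by exact_mod_cast hN
  set s : ℝ := ∑ i : Fin N, if w (t.succAbove i) = some j then 1 else 0 with hs
  have hs0 : 0 ≤ s := Finset.sum_nonneg fun i _ => by split_ifs <;> norm_num
  have hs1 : s ≤ N := by
    calc s ≤ ∑ _i : Fin N, (1 : ℝ) := Finset.sum_le_sum fun i _ => by split_ifs <;> norm_num
      _ = N := by simp
  set e : ℝ := if w t = some j then 1 else 0 with he
  have h1 : samplePoint γ (t.removeNth w) j = γ / N * s := rfl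
  have h2 : samplePoint γ w j = γ / ((N + 1 : ℕ) : ℝ) * (e + s) := by
    rw [samplePoint, Fin.sum_univ_succAbove _ t]
  have he' : 0 ≤ e ∧ e ≤ 1 := by rw [he]; split_ifs <;> norm_num
  have key : γ / N * s - γ / ((N + 1 : ℕ) : ℝ) * (e + s)
      = γ / (N + 1) * ((s - e * N) / N) := by
    push_cast
    field_simp
    ring
  rw [Real.dist_eq, h1, h2, key, abs_mul, abs_of_nonneg (by positivity : 0 ≤ γ / (N + 1 : ℝ))]
  refine mul_le_of_le_one_right (by positivity) ?_
  rw [abs_div, abs_of_pos hN', div_le_one hN', abs_le]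
  constructor <;> nlinarith

/-! ### Approximate Bernstein coefficients -/

/-- At all high levels `f` has a Bernstein expansion, indexed by words, whose coefficients are
uniformly close to the values of `f` at the sample points. -/
def HasBernsteinExpansions {n : ℕ} (γ : ℝ) (f : MvPolynomial (Fin n) ℝ) : Prop :=
  ∀ δ : ℝ, 0 < δ → ∀ᶠ N : ℕ in atTop, ∃ b : (Fin N → Option (Fin n)) → ℝ,
    MvPolynomial.C (γ ^ N) * f
      = ∑ w, MvPolynomial.C (b w) * ∏ t, barycentric n γ (w t) ∧
    ∀ w, |b w - MvPolynomial.eval (samplePoint γ w) f| ≤ δ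

theorem HasBernsteinExpansions.C {n : ℕ} (γ a : ℝ) :
    HasBernsteinExpansions γ (MvPolynomial.C a : MvPolynomial (Fin n) ℝ) := by
  refine fun δ hδ => Eventually.of_forall fun N => ⟨fun _ => a, ?_, fun w => by simpa using hδ.le⟩
  rw [← Finset.mul_sum, sum_prod_barycentric, mul_comm]

theorem HasBernsteinExpansions.add {n : ℕ} {γ : ℝ} {f g : MvPolynomial (Fin n) ℝ}
    (hf : HasBernsteinExpansions γ f) (hg : HasBernsteinExpansions γ g) :
    HasBernsteinExpansions γ (f + g) := by
  intro δ hδ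
  filter_upwards [hf (δ / 2) (by positivity), hg (δ / 2) (by positivity)]
  rintro N ⟨b, hb, hb'⟩ ⟨d, hd, hd'⟩
  refine ⟨fun w => b w + d w, ?_, fun w => ?_⟩
  · simp only [mul_add, hb, hd, map_add, add_mul, Finset.sum_add_distrib]
  · have h1 := abs_le.1 (hb' w)
    have h2 := abs_le.1 (hd' w)
    rw [map_add, abs_le]
    constructor <;> linarith

/-- Split off the letter at position `t`: only `some j` survives, and it contributes the factor `X
j`. -/
theorem sum_words_mark {n : ℕ} {γ : ℝ} {N : ℕ} (b : (Fin N → Option (Fin n)) → ℝ) (j : Fin n)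
    (t : Fin (N + 1)) :
    ∑ w : Fin (N + 1) → Option (Fin n),
        MvPolynomial.C (if w t = some j then b (t.removeNth w) else 0)
          * ∏ i, barycentric n γ (w i)
      = MvPolynomial.X j * ∑ w, MvPolynomial.C (b w) * ∏ i, barycentric n γ (w i) := by
  rw [← (Fin.insertNthEquiv (fun _ : Fin (N + 1) => Option (Fin n)) t).sum_comp,
    Fintype.sum_prod_type, Finset.sum_eq_single (some j)]
  · rw [Finset.mul_sum]
    refine Finset.sum_congr rfl fun w _ => ?_
    have h : t.removeNth (Fin.insertNthEquiv (fun _ : Fin (N + 1) => Option (Fin n)) t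
        (some j, w)) = w := Fin.removeNth_insertNth (α := fun _ => Option (Fin n)) t (some j) w
    rw [h]
    simp [Fin.prod_univ_succAbove _ t, barycentric]
    ring
  · intro a _ ha
    simp [ha]
  · simp

/-- The new coefficient averages over positions: delete each letter `j` in turn and evaluate `b` on
the shorter word. Deletion moves the sample point by at most `γ / (N + 1)`, so uniform continuity
controls the error. -/
theorem HasBernsteinExpansions.mul_X {n : ℕ} {γ : ℝ} (hγ : 0 < γ) {f : MvPolynomial (Fin n) ℝ}
    (hf : HasBernsteinExpansions γ f) (j : Fin n) :
    HasBernsteinExpansions γ (f * MvPolynomial.X j) := by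
  intro δ hδ
  -- Spent twice, on `b` and on moving the point; `N + 1` positions weighted by `γ / (N + 1)` turn
  -- `δ / γ` into `δ`.
  have hη : 0 < δ / (2 * γ) := by positivity
  have huc := (isCompact_simplex n γ).uniformContinuousOn_of_continuous
    (f := fun ξ => MvPolynomial.eval ξ f) (MvPolynomial.continuous_eval f).continuousOn
  obtain ⟨r, hr, hr'⟩ := Metric.uniformContinuousOn_iff.1 huc _ hη
  have hlim : ∀ᶠ N : ℕ in atTop, γ / ((N : ℝ) + 1) < r := by
    have h := (tendsto_one_div_add_atTop_nhds_zero_nat (𝕜 := ℝ)).const_mul γ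
    simp only [mul_zero, mul_one_div] at h
    exact h.eventually (gt_mem_nhds hr)
  rw [← map_add_atTop_eq_nat 1, eventually_map]
  filter_upwards [hf _ hη, hlim, eventually_gt_atTop 0]
  rintro N ⟨b, hb, hb'⟩ hNr hN
  refine ⟨fun w => γ / ((N + 1 : ℕ) : ℝ) * ∑ t, if w t = some j then b (t.removeNth w) else 0,
    ?_, fun w => ?_⟩
  · have h := Finset.sum_congr rfl fun (t : Fin (N + 1)) (_ : t ∈ Finset.univ) =>
      sum_words_mark (γ := γ) b j t
    rw [Finset.sum_comm] at h
    simp only [← Finset.sum_mul, ← map_sum, ← hb, Finset.sum_const, Finset.card_univ,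
      Fintype.card_fin] at h
    simp only [map_mul, mul_assoc]
    rw [← Finset.mul_sum, h, nsmul_eq_mul]
    have h1 : (((N + 1 : ℕ) : MvPolynomial (Fin n) ℝ)) = MvPolynomial.C ((N + 1 : ℕ) : ℝ) := by
      simp
    have h2 : γ ^ (N + 1) = γ / ((N + 1 : ℕ) : ℝ) * ((N + 1 : ℕ) : ℝ) * γ ^ N := by
      field_simp
      ring
    rw [h1, h2]
    simp only [map_mul]
    ring
  · have hsplit : γ / ((N + 1 : ℕ) : ℝ) * (∑ t, if w t = some j then b (t.removeNth w) else 0)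
        - MvPolynomial.eval (samplePoint γ w) (f * MvPolynomial.X j)
        = γ / ((N + 1 : ℕ) : ℝ) * ∑ t, if w t = some j then
          b (t.removeNth w) - MvPolynomial.eval (samplePoint γ w) f else 0 := by
      have : ∀ t, (if w t = some j then
          b (t.removeNth w) - MvPolynomial.eval (samplePoint γ w) f else 0)
          = (if w t = some j then b (t.removeNth w) else 0)
            - MvPolynomial.eval (samplePoint γ w) f * (if w t = some j then 1 else 0) := by
        intro t
        split_ifs <;> ring
      simp only [this, Finset.sum_sub_distrib, ← Finset.mul_sum, map_mul, MvPolynomial.eval_X]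
      rw [show samplePoint γ w j
        = γ / ((N + 1 : ℕ) : ℝ) * ∑ t, if w t = some j then 1 else 0 from rfl]
      ring
    have hterm : ∀ t, |if w t = some j then
          b (t.removeNth w) - MvPolynomial.eval (samplePoint γ w) f else 0| ≤ δ / γ := by
      intro t
      split_ifs
      · have h1 := abs_le.1 (hb' (t.removeNth w))
        have h2 := hr' _ (samplePoint_mem hγ.le (t.removeNth w)) _ (samplePoint_mem hγ.le w)
          ((dist_samplePoint_removeNth_le hγ.le hN w t).trans_lt hNr)
        rw [Real.dist_eq] at h2
        have h3 := abs_lt.1 h2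
        have h4 : δ / γ = δ / (2 * γ) + δ / (2 * γ) := by field_simp; ring
        rw [abs_le]
        constructor <;> linarith
      · simpa using (by positivity : 0 ≤ δ / γ)
    rw [hsplit, abs_mul, abs_of_nonneg (by positivity)]
    calc _ ≤ γ / ((N + 1 : ℕ) : ℝ) * ∑ _t : Fin (N + 1), δ / γ := by
          gcongr
          exact (Finset.abs_sum_le_sum_abs _ _).trans (Finset.sum_le_sum fun t _ => hterm t)
      _ = δ := by
          simp only [Finset.sum_const, Finset.card_univ, Fintype.card_fin, nsmul_eq_mul]
          field_simp

theorem hasBernsteinExpansions {n : ℕ} {γ : ℝ} (hγ : 0 < γ) (f : MvPolynomial (Fin n) ℝ) :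
    HasBernsteinExpansions γ f := by
  induction f using MvPolynomial.induction_on with
  | C a => exact .C γ a
  | add f g hf hg => exact hf.add hg
  | mul_X f j hf => exact hf.mul_X hγ j

/-! ### Uniform lower bound on the cylinder -/

theorem abs_pow_le_one_add_sq_pow (t : ℝ) {i k : ℕ} (hi : i ≤ 2 * k) :
    |t ^ i| ≤ (1 + t ^ 2) ^ k := by
  rw [abs_pow]
  rcases le_total |t| 1 with h | h
  · exact (pow_le_one₀ (abs_nonneg t) h).trans (one_le_pow₀ (by nlinarith [sq_nonneg t]))
  · calc |t| ^ i ≤ |t| ^ (2 * k) := pow_le_pow_right₀ h hi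
      _ = (t ^ 2) ^ k := by rw [pow_mul, sq_abs]
      _ ≤ _ := by gcongr; linarith

theorem exists_tail_lower_bound {k : ℕ} {m M : ℝ} (hm : 0 < m) (hM : 0 ≤ M) :
    ∃ R : ℝ, ∃ ε > 0, ∀ a : ℕ → ℝ, m ≤ a (2 * k) → (∀ i < 2 * k, |a i| ≤ M) →
      ∀ t : ℝ, R ≤ |t| →
        ε * (1 + t ^ 2) ^ k ≤ ∑ i ∈ Finset.range (2 * k + 1), a i * t ^ i := by
  -- Beyond this radius the `2 * k` lower terms cost at most half the leading one; `(1 / 2) ^ k`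
  -- comes from `1 + t² ≤ 2 t²`.
  refine ⟨max 1 (2 * (2 * k * M) / m), m / 2 * (1 / 2) ^ k, by positivity, ?_⟩
  intro a ha hai t ht
  have ht1 : 1 ≤ |t| := (le_max_left _ _).trans ht
  have ht2 : 2 * k * M ≤ m / 2 * |t| := by
    have h := (le_max_right _ _).trans ht
    rw [div_le_iff₀ hm] at h
    linarith
  have hsq : 1 ≤ t ^ 2 := by rw [← sq_abs]; nlinarith
  have htop : |t| ^ (2 * k) = t ^ (2 * k) := by rw [pow_mul, pow_mul, sq_abs]
  have hlow : |∑ i ∈ Finset.range (2 * k), a i * t ^ i| ≤ m / 2 * t ^ (2 * k) := by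
    rcases Nat.eq_zero_or_pos k with rfl | hk
    · simpa using (half_pos hm).le
    refine (Finset.abs_sum_le_sum_abs _ _).trans ?_
    calc _ ≤ ∑ i ∈ Finset.range (2 * k), M * |t| ^ (2 * k - 1) := by
          refine Finset.sum_le_sum fun i hi => ?_
          have hi' := Finset.mem_range.1 hi
          rw [abs_mul, abs_pow]
          exact mul_le_mul (hai i hi') (pow_le_pow_right₀ ht1 (by omega)) (by positivity) hM
      _ = (2 * k * M) * |t| ^ (2 * k - 1) := by simp; ring
      _ ≤ m / 2 * |t| * |t| ^ (2 * k - 1) := by gcongr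
      _ = m / 2 * t ^ (2 * k) := by
          rw [← htop, mul_assoc, ← pow_succ', Nat.sub_add_cancel (by omega)]
  have hpow : (1 / 2 : ℝ) ^ k * (1 + t ^ 2) ^ k ≤ t ^ (2 * k) := by
    rw [← mul_pow, pow_mul]
    gcongr
    linarith
  have hpos : 0 ≤ t ^ (2 * k) := htop ▸ by positivity
  rw [Finset.sum_range_succ]
  nlinarith [neg_abs_le (∑ i ∈ Finset.range (2 * k), a i * t ^ i)]

theorem exists_uniform_lower_bound {n k : ℕ} {γ : ℝ} {J : Set ℝ} (hJ : IsClosed J)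
    (c : ℕ → MvPolynomial (Fin n) ℝ)
    (hpos : ∀ ξ ∈ simplex n γ, ∀ t ∈ J,
      0 < ∑ i ∈ Finset.range (2 * k + 1), MvPolynomial.eval ξ (c i) * t ^ i)
    (hlead : ∀ ξ ∈ simplex n γ, 0 < MvPolynomial.eval ξ (c (2 * k))) :
    ∃ ε > 0, ∀ ξ ∈ simplex n γ, ∀ t ∈ J, ε * (1 + t ^ 2) ^ k
      ≤ ∑ i ∈ Finset.range (2 * k + 1), MvPolynomial.eval ξ (c i) * t ^ i := by
  have hcomp := isCompact_simplex n γ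
  obtain ⟨m, hm, hm'⟩ := hcomp.exists_forall_le' (a := 0)
    (MvPolynomial.continuous_eval (c (2 * k))).continuousOn hlead
  have hbd : ∀ i, ∃ B, ∀ ξ ∈ simplex n γ, |MvPolynomial.eval ξ (c i)| ≤ B := fun i =>
    hcomp.exists_bound_of_continuousOn (MvPolynomial.continuous_eval (c i)).continuousOn
  choose B hB using hbd
  obtain ⟨R, ε₁, hε₁, htail⟩ := exists_tail_lower_bound (k := k) (m := m)
    (M := ∑ i ∈ Finset.range (2 * k), |B i|) hm (by positivity)
  have hcomp' : IsCompact (simplex n γ ×ˢ (J ∩ Metric.closedBall 0 R)) :=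
    hcomp.prod ((isCompact_closedBall _ _).inter_left hJ)
  have hcont : Continuous fun z : (Fin n → ℝ) × ℝ =>
      (∑ i ∈ Finset.range (2 * k + 1), MvPolynomial.eval z.1 (c i) * z.2 ^ i)
        / (1 + z.2 ^ 2) ^ k := by
    refine Continuous.div (continuous_finsetSum _ fun i _ => ?_) (by fun_prop)
      fun z => by positivity
    exact ((MvPolynomial.continuous_eval (c i)).comp continuous_fst).mul (by fun_prop)
  obtain ⟨ε₂, hε₂, hmid⟩ := hcomp'.exists_forall_le' (a := 0) hcont.continuousOn
    fun z hz => div_pos (hpos _ hz.1 _ hz.2.1) (by positivity)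
  refine ⟨min ε₁ ε₂, lt_min hε₁ hε₂, fun ξ hξ t ht => ?_⟩
  rcases le_total R |t| with h | h
  · refine le_trans (by gcongr; exact min_le_left _ _)
      (htail (fun i => MvPolynomial.eval ξ (c i)) (hm' ξ hξ) (fun i hi => ?_) t h)
    exact ((hB i ξ hξ).trans (le_abs_self _)).trans
      (Finset.single_le_sum (f := fun i => |B i|) (fun i _ => abs_nonneg _)
        (Finset.mem_range.2 hi))
  · have h1 := hmid (ξ, t) ⟨hξ, ht, by simpa using h⟩
    rw [le_div_iff₀ (by positivity)] at h1
    exact le_trans (by gcongr; exact min_le_right _ _) h1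

theorem sum_mem_tensor {A : Type*} [CommRing A] [Algebra ℝ A] {S : Set A}
    {P : Set (Polynomial ℝ)} {ι : Type*} [Fintype ι] (s : ι → A) (q : ι → Polynomial ℝ)
    (hs : ∀ i, s i ∈ S) (hq : ∀ i, q i ∈ P) :
    ∑ i, Polynomial.C (s i) * (q i).map (algebraMap ℝ A) ∈ tensor S P :=
  ⟨Fintype.card ι, s ∘ (Fintype.equivFin ι).symm, q ∘ (Fintype.equivFin ι).symm,
    fun _ => hs _, fun _ => hq _,
    ((Fintype.equivFin ι).symm.sum_comp
      fun i => Polynomial.C (s i) * (q i).map (algebraMap ℝ A)).symm⟩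

end Cylinder

theorem proposition9p5 (n : ℕ) (hn : 1 ≤ n) (γ : ℝ) (hγ : 0 < γ)
    (J : Set ℝ) (hJ : IsClosed J) (k : ℕ)
    (c : ℕ → MvPolynomial (Fin n) ℝ) (p : Polynomial (MvPolynomial (Fin n) ℝ))
    (hp : p = ∑ i ∈ Finset.range (2 * k + 1), Polynomial.C (c i) * Polynomial.X ^ i)
    (hpos : ∀ ξ ∈ Cylinder.simplex n γ, ∀ η ∈ J,
      0 < Polynomial.eval₂ (MvPolynomial.eval ξ) η p)
    (hlead : ∀ θ ∈ Cylinder.simplex n γ, 0 < MvPolynomial.eval θ (c (2 * k))) :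
    ∃ ε : ℝ, 0 < ε ∧
      ∃ a ∈ Cylinder.tensor (Cylinder.simplexSemiring n γ) (Cylinder.Pos J),
        p = ε • (1 + Polynomial.X ^ 2) ^ k + a := by
  obtain ⟨ε, hε, hlow⟩ := Cylinder.exists_uniform_lower_bound (k := k) hJ c
    (fun ξ hξ t ht => by
      have h := hpos ξ hξ t ht
      simpa [hp, Polynomial.eval₂_finsetSum] using h) hlead
  -- The `2 * k + 1` coefficient errors together use up `ε / 2`.
  set δ : ℝ := ε / 2 / (2 * k + 1) with hδ
  have hδ0 : 0 < δ := by positivity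
  obtain ⟨N, hN⟩ := ((eventually_all_finset (Finset.range (2 * k + 1))).2 fun i _ =>
    Cylinder.hasBernsteinExpansions hγ (c i) δ hδ0).exists
  choose! b hb hbδ using hN
  let r : (Fin N → Option (Fin n)) → Polynomial ℝ := fun w =>
    ∑ i ∈ Finset.range (2 * k + 1), Polynomial.C (b i w) * Polynomial.X ^ i
      - Polynomial.C (ε / 2) * (1 + Polynomial.X ^ 2) ^ k
  have hr : ∀ w, ∀ t ∈ J, 0 ≤ (r w).eval t := by
    intro w t ht
    have h1 := hlow _ (Cylinder.samplePoint_mem hγ.le w) t ht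
    have h2 : ∑ i ∈ Finset.range (2 * k + 1),
        (MvPolynomial.eval (Cylinder.samplePoint γ w) (c i) * t ^ i - b i w * t ^ i)
        ≤ ∑ _i ∈ Finset.range (2 * k + 1), δ * (1 + t ^ 2) ^ k := by
      refine Finset.sum_le_sum fun i hi => (le_abs_self _).trans ?_
      rw [← sub_mul, abs_mul, abs_sub_comm]
      exact mul_le_mul (hbδ i hi w)
        (Cylinder.abs_pow_le_one_add_sq_pow t (by have := Finset.mem_range.1 hi; omega))
        (abs_nonneg _) hδ0.le
    have h3 : ∑ _i ∈ Finset.range (2 * k + 1), δ * (1 + t ^ 2) ^ k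
        = ε / 2 * (1 + t ^ 2) ^ k := by
      simp only [Finset.sum_const, Finset.card_range, nsmul_eq_mul, hδ]
      push_cast
      field_simp
    rw [Finset.sum_sub_distrib, h3] at h2
    simp only [r, Polynomial.eval_sub, Polynomial.eval_finsetSum, Polynomial.eval_mul,
      Polynomial.eval_C, Polynomial.eval_pow, Polynomial.eval_X, Polynomial.eval_add,
      Polynomial.eval_one]
    linarith
  -- The factor `γ⁻¹ ^ N`, which undoes the scaling by `γ ^ N`, is absorbed into the `Pos J` side.
  refine ⟨ε / 2, by positivity, _, Cylinder.sum_mem_tensor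
    (fun w : Fin N → Option (Fin n) => ∏ t, Cylinder.barycentric n γ (w t))
    (fun w => Polynomial.C (γ⁻¹ ^ N) * r w) (Cylinder.prod_barycentric_mem n γ) ?_, ?_⟩
  · intro w t ht
    rw [Polynomial.eval_mul, Polynomial.eval_C]
    exact mul_nonneg (by positivity) (hr w t ht)
  have hscale : Polynomial.C (MvPolynomial.C (γ⁻¹ ^ N) : MvPolynomial (Fin n) ℝ)
      * Polynomial.C (MvPolynomial.C (γ ^ N)) = 1 := by
    rw [← map_mul, ← map_mul, ← mul_pow, inv_mul_cancel₀ hγ.ne']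
    simp
  have hcoef : ∑ w : Fin N → Option (Fin n),
      Polynomial.C (∏ t, Cylinder.barycentric n γ (w t))
        * (∑ i ∈ Finset.range (2 * k + 1),
            Polynomial.C (MvPolynomial.C (b i w)) * Polynomial.X ^ i)
      = Polynomial.C (MvPolynomial.C (γ ^ N)) * p := by
    rw [hp, Finset.mul_sum]
    simp only [Finset.mul_sum]
    rw [Finset.sum_comm]
    refine Finset.sum_congr rfl fun i hi => ?_
    rw [← mul_assoc, ← map_mul, hb i hi, map_sum, Finset.sum_mul]
    refine Finset.sum_congr rfl fun w _ => ?_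
    rw [map_mul]
    ring
  have hsmul : (ε / 2) • (1 + Polynomial.X ^ 2 : Polynomial (MvPolynomial (Fin n) ℝ)) ^ k
      = Polynomial.C (MvPolynomial.C (ε / 2)) * (1 + Polynomial.X ^ 2) ^ k := by
    rw [Algebra.smul_def]
    rfl
  have hmap : ∀ w, (r w).map (algebraMap ℝ (MvPolynomial (Fin n) ℝ))
      = ∑ i ∈ Finset.range (2 * k + 1),
          Polynomial.C (MvPolynomial.C (b i w)) * Polynomial.X ^ i
        - Polynomial.C (MvPolynomial.C (ε / 2)) * (1 + Polynomial.X ^ 2) ^ k := by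
    intro w
    simp [r, Polynomial.map_sum, MvPolynomial.algebraMap_eq]
  have hterm : ∀ w : Fin N → Option (Fin n),
      Polynomial.C (∏ t, Cylinder.barycentric n γ (w t))
        * (Polynomial.C (γ⁻¹ ^ N) * r w).map (algebraMap ℝ (MvPolynomial (Fin n) ℝ))
      = Polynomial.C (MvPolynomial.C (γ⁻¹ ^ N))
        * (Polynomial.C (∏ t, Cylinder.barycentric n γ (w t))
            * (∑ i ∈ Finset.range (2 * k + 1),
              Polynomial.C (MvPolynomial.C (b i w)) * Polynomial.X ^ i)
          - Polynomial.C (∏ t, Cylinder.barycentric n γ (w t))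
            * (Polynomial.C (MvPolynomial.C (ε / 2)) * (1 + Polynomial.X ^ 2) ^ k)) := by
    intro w
    rw [Polynomial.map_mul, Polynomial.map_C, hmap, MvPolynomial.algebraMap_eq]
    ring
  rw [Finset.sum_congr rfl fun w _ => hterm w, ← Finset.mul_sum, Finset.sum_sub_distrib, hcoef,
    ← Finset.sum_mul, ← map_sum, Cylinder.sum_prod_barycentric, ← mul_sub, ← mul_assoc, hscale,
    hsmul]
  ring
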